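/- Let $(a;q)_\infty=\prod_{j=0}^{\infty}(1-aq^j)$, and let $\mathfrak{B}_5(n)$ denote the $5$ dots bracelet partition function, that is, the coefficients of the generating function $$\sum_{n=0}^{\infty}\mathfrak{B}_5(n)q^n=\frac{(-q;q)_\infty}{(q;q)_\infty^{4}\,(-q^5;q^5)_\infty}.$$ Then for all integers $\alpha\ge 1$ and $n\ge 0$ we have \begin{align*} \mathfrak{B}_5\Big(8\cdot 5^{2\alpha}n+\frac{31\cdot 5^{2\alpha-1}+1}{3}\Big)&\equiv 0 \pmod 2,\\ \mathfrak{B}_5\Big(8\cdot 5^{2\alpha}n+\frac{79\cdot 5^{2\alpha-1}+1}{3}\Big)&\equiv 0 \pmod 2,\\ \mathfrak{B}_5\Big(8\cdot 5^{2\alpha+1}n+\frac{83\cdot 5^{2\alpha}+1}{3}\Big)&\equiv 0 \pmod 2,\\ \mathfrak{B}_5\Big(8\cdot 5^{2\alpha+1}n+\frac{107\cdot 5^{2\alpha}+1}{3}\Big)&\equiv 0 \pmod 2. \end{align*} -/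

import Mathlib

open scoped PowerSeries.WithPiTopology in
/-- The infinite `q`-shifted factorial `(a; q)_∞ = ∏_{j ≥ 0} (1 - a q ^ j)` for formal power series
`a`, `q` with integer coefficients. The product is taken coefficientwise (the topology on `ℤ⟦X⟧`
is the product of the discrete topologies on the coefficients). -/
noncomputable def qShiftedFactorial (a q : PowerSeries ℤ) : PowerSeries ℤ :=
  ∏' j : ℕ, (1 - a * q ^ j)

/-- The denominator `(q; q)_∞ ^ (k - 1) (-q ^ k; q ^ k)_∞`, with `q` the formal variable. -/
noncomputable def braceletDenominator (k : ℕ) : PowerSeries ℤ :=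
  qShiftedFactorial PowerSeries.X PowerSeries.X ^ (k - 1) *
    qShiftedFactorial (-PowerSeries.X ^ k) (PowerSeries.X ^ k)

/-- The generating function
`(-q; q)_∞ / ((q; q)_∞ ^ (k - 1) (-q ^ k; q ^ k)_∞)` of the `k` dots bracelet partitions (`k ≥ 3`).
The denominator has constant coefficient `1`, and `PowerSeries.invOfUnit _ 1` is its inverse. -/
noncomputable def braceletGenFun (k : ℕ) : PowerSeries ℤ :=
  qShiftedFactorial (-PowerSeries.X) PowerSeries.X *
    PowerSeries.invOfUnit (braceletDenominator k) 1

/-- The `k` dots bracelet partition function `𝔅_k(n)`, `k ≥ 3`: the coefficient of `q ^ n` in the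
generating function. -/
noncomputable def bracelet (k n : ℕ) : ℤ :=
  PowerSeries.coeff n (braceletGenFun k)

open scoped PowerSeries.WithPiTopology in
/-- The infinite product defining `(a; q)_∞` converges when `a` and `q` have zero constant
coefficient. -/
theorem qShiftedFactorial_multipliable (a q : PowerSeries ℤ)
    (ha : PowerSeries.constantCoeff a = 0) (hq : PowerSeries.constantCoeff q = 0) :
    Multipliable fun j : ℕ => 1 - a * q ^ j := by
  have key : Multipliable fun j : ℕ => 1 + (-(a * q ^ j)) := by
    apply PowerSeries.WithPiTopology.multipliable_one_add_of_tendsto_order_atTop_nhds_top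
    refine ENat.tendsto_nhds_top_iff_natCast_lt.mpr fun n =>
      Filter.eventually_atTop.mpr ⟨n, fun m hm => ?_⟩
    have hdvd : (PowerSeries.X : PowerSeries ℤ) ^ (m + 1) ∣ -(a * q ^ m) := by
      rw [dvd_neg, pow_succ']
      exact mul_dvd_mul (PowerSeries.X_dvd_iff.mpr ha)
        (pow_dvd_pow_of_dvd (PowerSeries.X_dvd_iff.mpr hq) m)
    have h1 : ((m + 1 : ℕ) : ℕ∞) ≤ (-(a * q ^ m)).order := by
      rw [PowerSeries.X_pow_dvd_iff] at hdvd
      exact PowerSeries.nat_le_order _ _ hdvd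
    exact lt_of_lt_of_le (by exact_mod_cast Nat.lt_succ_of_le hm) h1
  simpa [sub_eq_add_neg] using key

open scoped PowerSeries.WithPiTopology in
theorem constantCoeff_qShiftedFactorial (a q : PowerSeries ℤ)
    (ha : PowerSeries.constantCoeff a = 0) (hq : PowerSeries.constantCoeff q = 0) :
    PowerSeries.constantCoeff (qShiftedFactorial a q) = 1 := by
  rw [qShiftedFactorial, (qShiftedFactorial_multipliable a q ha hq).map_tprod
    (PowerSeries.constantCoeff (R := ℤ))
    (PowerSeries.WithPiTopology.continuous_constantCoeff ℤ)]
  simp [ha]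

/-- The series `∑ 𝔅_k(n) q ^ n` is the quotient of `(-q; q)_∞` by the denominator. -/
theorem braceletGenFun_mul_denominator (k : ℕ) (hk : 3 ≤ k) :
    PowerSeries.mk (bracelet k) * braceletDenominator k =
      qShiftedFactorial (-PowerSeries.X) PowerSeries.X := by
  have hmk : PowerSeries.mk (bracelet k) = braceletGenFun k := by
    ext n
    simp [bracelet]
  have hk0 : k ≠ 0 := by omega
  have hc : PowerSeries.constantCoeff (braceletDenominator k) = ((1 : ℤˣ) : ℤ) := by
    rw [braceletDenominator, map_mul, map_pow,
      constantCoeff_qShiftedFactorial _ _ (by simp) (by simp),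
      constantCoeff_qShiftedFactorial _ _ (by simp [hk0]) (by simp [hk0])]
    simp
  rw [hmk, braceletGenFun, mul_assoc, PowerSeries.invOfUnit_mul _ _ hc, mul_one]

/-! Write `f_k` for `(q^k; q^k)_∞`. Signs vanish modulo 2, so the generating function becomes `1 /
(f_1^3 f_5)`. The engine is the congruence `f_1 f_5 ≡ f_2^3 + q f_10^3`, which separates even from
odd exponents. With `f_k^2 ≡ f_{2k}` it gives in turn `∑ 𝔅_5(2n) q^n ≡ f_1 / f_5`, `∑ 𝔅_5(4n) q^n ≡
f_1^3 / f_5` and `∑ 𝔅_5(8n+4) q^n ≡ f_1 f_10` (`bisect_bisect_bisect_eq`).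

By the pentagonal number theorem an odd value at `i = 8N + 4` forces `3i - 1 = 24N + 11 = x^2 +
10y^2`. In the four progressions `3i - 1` is `25^k` times either `5u` with `u ≡ ±1` or `u` with `u ≡
±2` modulo 5; descent by 25 and squares modulo 5 exclude such a representation.

The engine, like the expansion of `f_1^3`, is proved by counting: coefficients of `f_1 f_D` for `D =
2, 5` are parities of numbers of solutions of `a^2 + D b^2 = M`, found from involutions and
multiplication in `ℤ[√-D]`. -/

/-! ### Parity of the number of representations by `a^2 + 2b^2` and `a^2 + 5b^2`. -/

/-- The solutions of `a ^ 2 + D * b ^ 2 = M` with `a + b ≡ 2` modulo `3`. -/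
noncomputable def formReps (D M : ℤ) : Finset (ℤ × ℤ) :=
  (Finset.Icc (-M) M ×ˢ Finset.Icc (-M) M).filter fun p =>
    p.1 ^ 2 + D * p.2 ^ 2 = M ∧ (p.1 + p.2) % 3 = 2

theorem mem_formReps {D M : ℤ} (hD : 0 < D) {p : ℤ × ℤ} :
    p ∈ formReps D M ↔ p.1 ^ 2 + D * p.2 ^ 2 = M ∧ (p.1 + p.2) % 3 = 2 := by
  obtain ⟨a, b⟩ := p
  simp only [formReps, Finset.mem_filter, Finset.mem_product, Finset.mem_Icc,
    and_iff_right_iff_imp]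
  rintro ⟨h, -⟩
  have ha : |a| ≤ M := by
    have h1 : |a| ≤ a ^ 2 := by
      rw [← sq_abs]; exact Int.le_self_sq _
    nlinarith [sq_nonneg b]
  have hb : |b| ≤ M := by
    have h1 : |b| ≤ b ^ 2 := by
      rw [← sq_abs]; exact Int.le_self_sq _
    nlinarith [sq_nonneg a, sq_nonneg b]
  exact ⟨abs_le.mp ha, abs_le.mp hb⟩

theorem Finset.natCast_card_eq_zero_of_involution {α : Type*} (s : Finset α) (g : α → α)
    (hg : ∀ a ∈ s, g a ≠ a) (hs : ∀ a ∈ s, g a ∈ s) (hgg : ∀ a ∈ s, g (g a) = a) :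
    (s.card : ZMod 2) = 0 := by
  have h := Finset.sum_involution (s := s) (f := fun _ => (1 : ZMod 2)) (fun a _ => g a)
    (fun _ _ => by decide) (fun a ha _ => hg a ha) (fun a ha => hs a ha) (fun a ha => hgg a ha)
  simpa using h

theorem sq_emod_three (a : ℤ) : a ^ 2 % 3 = if a % 3 = 0 then 0 else 1 := by
  rcases (by omega : a % 3 = 0 ∨ a % 3 = 1 ∨ a % 3 = 2) with h | h | h <;>
    simp [pow_two, Int.mul_emod, h]

theorem form_emod_three {D : ℤ} (hD : D % 3 = 2) (a b : ℤ) :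
    (a ^ 2 + D * b ^ 2) % 3 =
      ((if a % 3 = 0 then 0 else 1) + 2 * (if b % 3 = 0 then 0 else 1)) % 3 := by
  rw [Int.add_emod, Int.mul_emod, hD, sq_emod_three, sq_emod_three]
  split_ifs <;> rfl

/-- The involution changing the sign of the coordinate divisible by `3`. -/
def flipMultipleOfThree (p : ℤ × ℤ) : ℤ × ℤ :=
  if p.2 % 3 = 0 then (p.1, -p.2) else (-p.1, p.2)

theorem exists_sq_emod_three {M s : ℤ} (h : M = s ^ 2) (h3 : M % 3 ≠ 0) :
    ∃ t : ℤ, M = t ^ 2 ∧ t % 3 = 2 := by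
  have hs := sq_emod_three s
  rcases (by omega : s % 3 = 0 ∨ s % 3 = 1 ∨ s % 3 = 2) with h0 | h0 | h0
  · simp only [h0, if_true] at hs; omega
  · exact ⟨-s, by rw [h]; ring, by omega⟩
  · exact ⟨s, h, h0⟩

-- Since `M ≡ a^2 - b^2` is nonzero modulo 3, exactly one coordinate is divisible by 3, and changing
-- its sign keeps `a + b` modulo 3. A fixed point has that coordinate zero, and the other coordinate
-- has its sign determined by being 2 modulo 3.
open Classical in
theorem natCast_card_formReps_of_not_dvd {D M : ℤ} (hD0 : 0 < D) (hD : D % 3 = 2)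
    (hM : M % 3 ≠ 0) :
    ((formReps D M).card : ZMod 2) =
      (if ∃ s : ℤ, M = s ^ 2 then 1 else 0) + (if ∃ s : ℤ, M = D * s ^ 2 then 1 else 0) := by
  have hcases : ∀ p ∈ formReps D M, (p.1 % 3 = 2 ∧ p.2 % 3 = 0) ∨ (p.1 % 3 = 0 ∧ p.2 % 3 = 2) := by
    intro p hp
    obtain ⟨h1, h2⟩ := (mem_formReps hD0).mp hp
    have := form_emod_three hD p.1 p.2
    rw [h1] at this
    split_ifs at this <;> omega
  have hsplit := Finset.card_filter_add_card_filter_not (s := formReps D M)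
    (fun p => flipMultipleOfThree p = p)
  have hne : (((formReps D M).filter fun p => ¬ flipMultipleOfThree p = p).card : ZMod 2) = 0 := by
    have key : ∀ p ∈ formReps D M, flipMultipleOfThree p ∈ formReps D M ∧
        flipMultipleOfThree (flipMultipleOfThree p) = p := by
      intro p hp
      have hc := hcases p hp
      rw [mem_formReps hD0] at hp ⊢
      obtain ⟨h1, h2⟩ := hp
      by_cases h : p.2 % 3 = 0
      · have hflip : flipMultipleOfThree p = (p.1, -p.2) := if_pos h
        rw [hflip]
        refine ⟨⟨by simpa using h1, by simp only; omega⟩, ?_⟩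
        rw [flipMultipleOfThree, if_pos (by simp only; omega), neg_neg]
      · have hflip : flipMultipleOfThree p = (-p.1, p.2) := if_neg h
        rw [hflip]
        refine ⟨⟨by simpa using h1, by simp only; omega⟩, ?_⟩
        rw [flipMultipleOfThree, if_neg h, neg_neg]
    apply Finset.natCast_card_eq_zero_of_involution _ flipMultipleOfThree
    · intro p hp; exact (Finset.mem_filter.mp hp).2
    · intro p hp
      rw [Finset.mem_filter] at hp ⊢
      refine ⟨(key p hp.1).1, ?_⟩
      rw [(key p hp.1).2]
      exact fun h => hp.2 h.symm
    · intro p hp; exact (key p (Finset.mem_filter.mp hp).1).2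
  have hfix : ∀ p : ℤ × ℤ, p ∈ (formReps D M).filter (fun p => flipMultipleOfThree p = p) ↔
      (p.2 = 0 ∧ p.1 % 3 = 2 ∧ M = p.1 ^ 2) ∨ (p.1 = 0 ∧ p.2 % 3 = 2 ∧ M = D * p.2 ^ 2) := by
    rintro ⟨a, b⟩
    rw [Finset.mem_filter]
    constructor
    · rintro ⟨hp, hf⟩
      have hc := hcases _ hp
      obtain ⟨h1, h2⟩ := (mem_formReps hD0).mp hp
      simp only [flipMultipleOfThree] at *
      rcases hc with hc | hc
      · rw [if_pos hc.2, Prod.mk.injEq] at hf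
        have hb : b = 0 := by omega
        subst hb
        exact Or.inl ⟨rfl, hc.1, by rw [← h1]; ring⟩
      · rw [if_neg (by omega), Prod.mk.injEq] at hf
        have ha : a = 0 := by omega
        subst ha
        exact Or.inr ⟨rfl, hc.2, by rw [← h1]; ring⟩
    · rw [mem_formReps hD0]
      simp only [flipMultipleOfThree]
      rintro (⟨rfl, h2, h3⟩ | ⟨rfl, h2, h3⟩)
      · exact ⟨⟨by rw [h3]; ring, by omega⟩, by simp⟩
      · exact ⟨⟨by rw [h3]; ring, by omega⟩, by rw [if_neg (by omega)]; simp⟩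
  have hcard : ((formReps D M).card : ZMod 2) =
      (((formReps D M).filter fun p => flipMultipleOfThree p = p).card : ZMod 2) := by
    rw [← hsplit, Nat.cast_add, hne, add_zero]
  rw [hcard]
  have hsq_mod : ∀ s : ℤ, M = s ^ 2 → M % 3 = 1 := by
    intro s hs
    have := sq_emod_three s
    split_ifs at this <;> omega
  have hDsq_mod : ∀ s : ℤ, M = D * s ^ 2 → M % 3 = 2 := by
    intro s hs
    have := form_emod_three hD 0 s
    rw [show (0 : ℤ) ^ 2 + D * s ^ 2 = M by rw [hs]; ring] at this
    split_ifs at this <;> omega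
  by_cases hA : ∃ s : ℤ, M = s ^ 2
  · have hB : ¬ ∃ s : ℤ, M = D * s ^ 2 := by
      rintro ⟨s, hs⟩
      obtain ⟨t, ht⟩ := hA
      have := hsq_mod t ht
      have := hDsq_mod s hs
      omega
    obtain ⟨s, hs⟩ := hA
    obtain ⟨t, ht, ht3⟩ := exists_sq_emod_three hs hM
    rw [if_pos ⟨s, hs⟩, if_neg hB, Finset.card_eq_one.mpr ⟨(t, 0), ?_⟩]
    · simp
    · ext ⟨a, b⟩
      rw [hfix, Finset.mem_singleton, Prod.mk.injEq]
      constructor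
      · rintro (⟨h1, h2, h3⟩ | ⟨h1, h2, h3⟩)
        · refine ⟨?_, h1⟩
          rcases sq_eq_sq_iff_eq_or_eq_neg.mp (h3.symm.trans ht) with h | h
          · exact h
          · simp only at h h2; omega
        · exact absurd ⟨_, h3⟩ hB
      · rintro ⟨rfl, rfl⟩
        exact Or.inl ⟨rfl, ht3, ht⟩
  · by_cases hB : ∃ s : ℤ, M = D * s ^ 2
    · obtain ⟨s, hs⟩ := hB
      have hs3 : s ^ 2 % 3 ≠ 0 := by
        intro h
        have := hDsq_mod s hs
        rw [hs, Int.mul_emod, h] at this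
        simp at this
      obtain ⟨t, ht, ht3⟩ := exists_sq_emod_three rfl hs3
      rw [if_neg hA, if_pos ⟨s, hs⟩, Finset.card_eq_one.mpr ⟨(0, t), ?_⟩]
      · simp
      · ext ⟨a, b⟩
        rw [hfix, Finset.mem_singleton, Prod.mk.injEq]
        constructor
        · rintro (⟨h1, h2, h3⟩ | ⟨h1, h2, h3⟩)
          · exact absurd ⟨_, h3⟩ hA
          · refine ⟨h1, ?_⟩
            rw [hs, ht] at h3
            rcases sq_eq_sq_iff_eq_or_eq_neg.mp (mul_left_cancel₀ hD0.ne' h3) with h | h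
            · exact h.symm
            · simp only at h h2; omega
        · rintro ⟨rfl, rfl⟩
          exact Or.inr ⟨rfl, ht3, by rw [hs, ht]⟩
    · rw [if_neg hA, if_neg hB, Finset.card_eq_zero.mpr]
      · simp
      · rw [Finset.eq_empty_iff_forall_notMem]
        intro p hp
        rcases (hfix p).mp hp with h | h
        · exact hA ⟨_, h.2.2⟩
        · exact hB ⟨_, h.2.2⟩

theorem emod_three_of_form_emod_three_eq_zero {D : ℤ} (hD : D % 3 = 2) {a b : ℤ}
    (h : (a ^ 2 + D * b ^ 2) % 3 = 0) (hab : (a + b) % 3 = 2) : a % 3 = 1 ∧ b % 3 = 1 := by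
  rw [form_emod_three hD] at h
  split_ifs at h <;> omega

/-- The bijection is multiplication by `-(1 + √-2)`, of norm 3, in `ℤ[√-2]`; the sign is chosen to
preserve `a + b` modulo 3. It is onto because `a ≡ b ≡ 1` modulo 3 makes the division exact. -/
theorem card_formReps_two_three_mul (M : ℤ) :
    (formReps 2 (3 * M)).card = (formReps 2 M).card := by
  symm
  refine Finset.card_bij' (fun p _ => (2 * p.2 - p.1, -p.1 - p.2))
    (fun p _ => (-((p.1 + 2 * p.2) / 3), (p.1 - p.2) / 3)) ?_ ?_ ?_ ?_
  · rintro ⟨c, d⟩ hp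
    rw [mem_formReps (by norm_num)] at hp ⊢
    obtain ⟨h1, h2⟩ := hp
    simp only at *
    exact ⟨by rw [← h1]; ring, by omega⟩
  · rintro ⟨a, b⟩ hp
    rw [mem_formReps (by norm_num)] at hp ⊢
    obtain ⟨h1, h2⟩ := hp
    simp only at *
    obtain ⟨ha, hb⟩ := emod_three_of_form_emod_three_eq_zero (D := 2) rfl (by omega) h2
    obtain ⟨c, hc⟩ : ∃ c, a + 2 * b = 3 * c := ⟨(a + 2 * b) / 3, by omega⟩
    obtain ⟨d, hd⟩ : ∃ d, a - b = 3 * d := ⟨(a - b) / 3, by omega⟩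
    obtain rfl : b = c - d := by omega
    obtain rfl : a = c + 2 * d := by omega
    rw [hc, hd, Int.mul_ediv_cancel_left _ (by norm_num), Int.mul_ediv_cancel_left _ (by norm_num)]
    exact ⟨by linarith, by omega⟩
  · rintro ⟨c, d⟩ hp
    simp only [Prod.mk.injEq]
    omega
  · rintro ⟨a, b⟩ hp
    rw [mem_formReps (by norm_num)] at hp
    obtain ⟨h1, h2⟩ := hp
    simp only [Prod.mk.injEq] at *
    obtain ⟨ha, hb⟩ := emod_three_of_form_emod_three_eq_zero (D := 2) rfl (by omega) h2
    omega

/-- The primes above 3 in `ℤ[√-5]` are not principal but their squares are, so the step is by 9: the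
bijection is multiplication by `2 - √-5`, of norm 9. -/
theorem card_formReps_five_nine_mul (M : ℤ) :
    (formReps 5 (9 * M)).card = (formReps 5 M).card := by
  have key : ∀ p ∈ formReps 5 (9 * M), ∃ c d : ℤ, p = (2 * c + 5 * d, 2 * d - c) := by
    rintro ⟨a, b⟩ hp
    rw [mem_formReps (by norm_num)] at hp
    obtain ⟨h1, h2⟩ := hp
    simp only at *
    obtain ⟨ha, hb⟩ := emod_three_of_form_emod_three_eq_zero (D := 5) rfl (by omega) h2
    obtain ⟨i, rfl⟩ : ∃ i, a = 1 + 3 * i := ⟨a / 3, by omega⟩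
    obtain ⟨j, rfl⟩ : ∃ j, b = 1 + 3 * j := ⟨b / 3, by omega⟩
    -- This forces `3 ∣ 1 + i + 5j`, which makes both quotients by 9 below exact.
    have h3 : 6 * (1 + i + 5 * j) + 9 * (i ^ 2 + 5 * j ^ 2) = 9 * M := by rw [← h1]; ring
    refine ⟨(2 * (1 + 3 * i) - 5 * (1 + 3 * j)) / 9, ((1 + 3 * i) + 2 * (1 + 3 * j)) / 9, ?_⟩
    rw [Prod.mk.injEq]
    omega
  symm
  refine Finset.card_bij (fun p _ => (2 * p.1 + 5 * p.2, 2 * p.2 - p.1)) ?_ ?_ ?_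
  · rintro ⟨c, d⟩ hp
    rw [mem_formReps (by norm_num)] at hp ⊢
    obtain ⟨h1, h2⟩ := hp
    simp only at *
    exact ⟨by rw [← h1]; ring, by omega⟩
  · rintro ⟨a, b⟩ - ⟨c, d⟩ - h
    simp only [Prod.mk.injEq] at *
    omega
  · intro p hp
    obtain ⟨c, d, rfl⟩ := key p hp
    refine ⟨(c, d), ?_, rfl⟩
    rw [mem_formReps (by norm_num)] at hp ⊢
    obtain ⟨h1, h2⟩ := hp
    simp only at *
    exact ⟨by linarith, by omega⟩

/-- With `a = b + 3c` the equation becomes `2b^2 + 2bc + 3c^2 = M`, the other form of discriminant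
-20. It has the automorphism `(b, c) ↦ (-b - c, c)`, which up to sign gives an involution without
fixed points, because `c` is odd. -/
theorem natCast_card_formReps_five_three_mul {M : ℤ} (hM : M % 3 ≠ 0) (hodd : M % 2 = 1) :
    ((formReps 5 (3 * M)).card : ZMod 2) = 0 := by
  have key : ∀ p ∈ formReps 5 (3 * M), ∃ b c : ℤ, p = (b + 3 * c, b) ∧ b % 3 = 1 ∧
      (c % 3 = 0 ∨ c % 3 = 1) ∧ c % 2 = 1 ∧ 2 * b ^ 2 + 2 * (b * c) + 3 * c ^ 2 = M := by
    rintro ⟨a, b⟩ hp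
    rw [mem_formReps (by norm_num)] at hp
    obtain ⟨h1, h2⟩ := hp
    simp only at *
    obtain ⟨ha, hb⟩ := emod_three_of_form_emod_three_eq_zero (D := 5) rfl (by omega) h2
    obtain ⟨c, hc⟩ : ∃ c, a = b + 3 * c := ⟨(a - b) / 3, by omega⟩
    subst hc
    have hform : 2 * b ^ 2 + 2 * (b * c) + 3 * c ^ 2 = M := by linarith
    refine ⟨b, c, rfl, hb, ?_, ?_, hform⟩
    · by_contra hcon
      obtain ⟨i, rfl⟩ : ∃ i, b = 1 + 3 * i := ⟨b / 3, by omega⟩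
      obtain ⟨j, rfl⟩ : ∃ j, c = 2 + 3 * j := ⟨c / 3, by omega⟩
      apply hM
      rw [← hform, show 2 * (1 + 3 * i) ^ 2 + 2 * ((1 + 3 * i) * (2 + 3 * j)) + 3 * (2 + 3 * j) ^ 2
        = 3 * (2 * (1 + 2 * i) * 1 + 6 * i ^ 2 + 2 * (2 * i + j + 3 * i * j) + (2 + 3 * j) ^ 2)
        by ring]
      exact Int.mul_emod_right _ _
    · by_contra hcon
      obtain ⟨j, rfl⟩ : ∃ j, c = 2 * j := ⟨c / 2, by omega⟩
      have : M = 2 * (b ^ 2 + b * (2 * j) + 6 * j ^ 2) := by rw [← hform]; ring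
      omega
  -- In the coordinates `(b, c)` this is `(b + c, -c)` if `3 ∣ c` and `(-b - c, c)` if `c ≡ 1`; the
  -- sign is the one that keeps `b ≡ 1` modulo 3.
  let g : ℤ × ℤ → ℤ × ℤ := fun p =>
    if ((p.1 - p.2) / 3) % 3 = 0 then
      (p.2 - 2 * ((p.1 - p.2) / 3), p.2 + (p.1 - p.2) / 3)
    else (-p.2 + 2 * ((p.1 - p.2) / 3), -p.2 - (p.1 - p.2) / 3)
  apply Finset.natCast_card_eq_zero_of_involution _ g
  · intro p hp
    obtain ⟨b, c, rfl, hb, hc3, hc2, -⟩ := key p hp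
    simp only [g]
    split_ifs <;> rw [Ne, Prod.mk.injEq] <;> omega
  · intro p hp
    obtain ⟨b, c, rfl, hb, hc3, hc2, hform⟩ := key p hp
    rw [mem_formReps (by norm_num)]
    have hdiv : (b + 3 * c - b) / 3 = c := by omega
    simp only [g, hdiv]
    split_ifs
    · simp only
      exact ⟨by rw [← hform]; ring, by omega⟩
    · simp only
      exact ⟨by rw [← hform]; ring, by omega⟩
  · intro p hp
    obtain ⟨b, c, rfl, hb, hc3, hc2, -⟩ := key p hp
    rcases hc3 with h | h
    · have hg : g (b + 3 * c, b) = (b - 2 * c, b + c) := by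
        simp only [g]
        rw [if_pos (by omega), Prod.mk.injEq]
        omega
      rw [hg]
      simp only [g]
      rw [if_pos (by omega), Prod.mk.injEq]
      omega
    · have hg : g (b + 3 * c, b) = (-b + 2 * c, -b - c) := by
        simp only [g]
        rw [if_neg (by omega), Prod.mk.injEq]
        omega
      rw [hg]
      simp only [g]
      rw [if_neg (by omega), Prod.mk.injEq]
      omega

theorem odd_sq_emod_eight {s : ℤ} (h : s ^ 2 % 2 = 1) : s ^ 2 % 8 = 1 := by
  have h2 : s % 2 = 1 := by
    by_contra hc
    rw [pow_two, Int.mul_emod, show s % 2 = 0 by omega] at h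
    simp at h
  obtain ⟨j, rfl⟩ : ∃ j, s = 2 * j + 1 := ⟨s / 2, by omega⟩
  obtain ⟨i, hi⟩ := Int.even_mul_succ_self j
  have : (2 * j + 1) ^ 2 = 8 * i + 1 := by linear_combination 4 * hi
  omega

theorem three_dvd_of_dvd_sq {s : ℤ} (h : s ^ 2 % 3 = 0) : ∃ t, s = 3 * t := by
  rw [sq_emod_three] at h
  split_ifs at h
  · exact ⟨s / 3, by omega⟩
  · omega

theorem exists_nine_mul_eq_iff {k M : ℤ} (hk : k % 3 ≠ 0) :
    (∃ s : ℤ, 9 * M = k * s ^ 2) ↔ ∃ s : ℤ, M = k * s ^ 2 := by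
  constructor
  · rintro ⟨s, hs⟩
    have h3 : (3 : ℤ) ∣ s ^ 2 := by
      have : (3 : ℤ) ∣ k * s ^ 2 := ⟨3 * M, by rw [← hs]; ring⟩
      exact (Int.prime_three.dvd_or_dvd this).resolve_left (by omega)
    obtain ⟨t, rfl⟩ := three_dvd_of_dvd_sq (s := s) (by omega)
    exact ⟨t, by linarith⟩
  · rintro ⟨s, hs⟩
    exact ⟨3 * s, by rw [hs]; ring⟩

theorem exists_three_mul_eq_sq_iff {M : ℤ} :
    (∃ s : ℤ, 3 * M = s ^ 2) ↔ ∃ s : ℤ, M = 3 * s ^ 2 := by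
  constructor
  · rintro ⟨s, hs⟩
    obtain ⟨t, rfl⟩ := three_dvd_of_dvd_sq (s := s) (by omega)
    exact ⟨t, by linarith⟩
  · rintro ⟨s, hs⟩
    exact ⟨3 * s, by rw [hs]; ring⟩

-- Dividing by 3 exchanges the classes 1 and 3 modulo 8, so both are treated in one induction; `N`
-- only bounds `M`.
open Classical in
theorem natCast_card_formReps_two (N : ℕ) : ∀ M : ℤ, 0 < M → M ≤ N →
    (M % 8 = 1 → ((formReps 2 M).card : ZMod 2) = if ∃ s : ℤ, M = s ^ 2 then 1 else 0) ∧
    (M % 8 = 3 → ((formReps 2 M).card : ZMod 2) = if ∃ s : ℤ, M = 3 * s ^ 2 then 1 else 0) := by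
  induction N with
  | zero => intro M h1 h2; simp at h2; omega
  | succ N ih =>
    intro M h1 h2
    push_cast at h2
    by_cases h3 : M % 3 = 0
    · obtain ⟨K, rfl⟩ : ∃ K, M = 3 * K := ⟨M / 3, by omega⟩
      obtain ⟨ih1, ih2⟩ := ih K (by omega) (by omega)
      rw [card_formReps_two_three_mul]
      refine ⟨fun h => ?_, fun h => ?_⟩
      · rw [ih2 (by omega)]
        simp only [exists_three_mul_eq_sq_iff]
      · rw [ih1 (by omega)]
        simp
    · rw [natCast_card_formReps_of_not_dvd (by norm_num) (by norm_num) h3]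
      refine ⟨fun h => ?_, fun h => ?_⟩
      · rw [if_neg (c := ∃ s : ℤ, M = 2 * s ^ 2) (by rintro ⟨s, hs⟩; omega), add_zero]
      · rw [if_neg (c := ∃ s : ℤ, M = 2 * s ^ 2) (by rintro ⟨s, hs⟩; omega),
          -- An odd square is 1 modulo 8, hence not 3.
          if_neg (c := ∃ s : ℤ, M = s ^ 2), if_neg (by rintro ⟨s, hs⟩; omega), add_zero]
        rintro ⟨s, hs⟩
        have := odd_sq_emod_eight (s := s) (by omega)
        omega

-- Induction removes factors 9. If 3 divides `M` exactly once, both sides vanish; if not at all, the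
-- sign-change count applies.
open Classical in
theorem natCast_card_formReps_five (N : ℕ) : ∀ M : ℤ, 0 < M → M ≤ N → M % 4 = 1 →
    ((formReps 5 M).card : ZMod 2) =
      (if ∃ s : ℤ, M = s ^ 2 then 1 else 0) + (if ∃ s : ℤ, M = 5 * s ^ 2 then 1 else 0) := by
  induction N with
  | zero => intro M h1 h2; simp at h2; omega
  | succ N ih =>
    intro M h1 h2 h4
    push_cast at h2
    by_cases h3 : M % 3 = 0
    · obtain ⟨K, rfl⟩ : ∃ K, M = 3 * K := ⟨M / 3, by omega⟩
      by_cases hK : K % 3 = 0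
      · obtain ⟨K, rfl⟩ : ∃ L, K = 3 * L := ⟨K / 3, by omega⟩
        have h9 : 3 * (3 * K) = 9 * K := by ring
        rw [h9, card_formReps_five_nine_mul, ih K (by omega) (by omega) (by omega)]
        have e1 := exists_nine_mul_eq_iff (k := 1) (M := K) (by norm_num)
        simp only [one_mul] at e1
        simp only [e1, exists_nine_mul_eq_iff (k := 5) (M := K) (by norm_num)]
      · rw [natCast_card_formReps_five_three_mul hK (by omega), if_neg, if_neg, add_zero]
        · rintro ⟨s, hs⟩
          have h3 : (3 : ℤ) ∣ s ^ 2 := by omega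
          obtain ⟨t, rfl⟩ := three_dvd_of_dvd_sq (s := s) (by omega)
          have : K = 3 * (5 * t ^ 2) := by linarith
          omega
        · rintro ⟨s, hs⟩
          obtain ⟨t, rfl⟩ := three_dvd_of_dvd_sq (s := s) (by omega)
          have : K = 3 * t ^ 2 := by linarith
          omega
    · exact natCast_card_formReps_of_not_dvd (by norm_num) (by norm_num) h3

/-! ### Bisection of series and pentagonal products modulo 2. -/

namespace PowerSeries

/-- In characteristic two, squaring a power series over the prime field substitutes `X ^ 2`. -/
theorem expand_two_zmod (f : (ZMod 2)⟦X⟧) : expand 2 two_ne_zero f = f ^ 2 := by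
  have h := MvPowerSeries.map_frobenius_expand (R := ZMod 2) (σ := Unit) 2 two_ne_zero (f := f)
  rw [ZMod.frobenius_zmod] at h
  exact h

/-- The series formed by the coefficients of even index (`r = 0`) or of odd index (`r = 1`). -/
noncomputable def bisect {R : Type*} [CommRing R] (r : ℕ) (f : R⟦X⟧) : R⟦X⟧ :=
  mk fun n => coeff (2 * n + r) f

section Bisect

variable {R : Type*} [CommRing R]

theorem bisect_add (r : ℕ) (f g : R⟦X⟧) : bisect r (f + g) = bisect r f + bisect r g := by
  ext n; simp [bisect]

theorem expand_bisect_add (f : R⟦X⟧) :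
    f = expand 2 two_ne_zero (bisect 0 f) + X * expand 2 two_ne_zero (bisect 1 f) := by
  ext n
  rcases Nat.even_or_odd' n with ⟨k, rfl | rfl⟩
  · rw [map_add, coeff_expand_mul]
    cases k with
    | zero => simp [bisect]
    | succ k =>
      rw [show 2 * (k + 1) = (2 * k + 1) + 1 by ring, coeff_succ_X_mul,
        coeff_expand_of_not_dvd _ _ _ (by omega)]
      simp [bisect, show 2 * (k + 1) = (2 * k + 1) + 1 by ring]
  · rw [map_add, coeff_succ_X_mul, coeff_expand_mul, coeff_expand_of_not_dvd _ _ _ (by omega)]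
    simp [bisect]

theorem bisect_zero_expand (f : R⟦X⟧) : bisect 0 (expand 2 two_ne_zero f) = f := by
  ext n; simp [bisect, coeff_expand_mul]

theorem bisect_one_expand (f : R⟦X⟧) : bisect 1 (expand 2 two_ne_zero f) = 0 := by
  ext n; simp [bisect, coeff_expand_of_not_dvd]

theorem bisect_one_X_mul_expand (f : R⟦X⟧) : bisect 1 (X * expand 2 two_ne_zero f) = f := by
  ext n; simp [bisect, coeff_succ_X_mul, coeff_expand_mul]

theorem bisect_zero_X_mul_expand (f : R⟦X⟧) : bisect 0 (X * expand 2 two_ne_zero f) = 0 := by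
  ext n
  cases n with
  | zero => simp [bisect]
  | succ n =>
    simp only [bisect, coeff_mk, map_zero]
    rw [show 2 * (n + 1) + 0 = (2 * n + 1) + 1 by ring, coeff_succ_X_mul,
      coeff_expand_of_not_dvd _ _ _ (by omega)]

theorem bisect_zero_mul_expand (f g : R⟦X⟧) :
    bisect 0 (f * expand 2 two_ne_zero g) = bisect 0 f * g := by
  conv_lhs => rw [expand_bisect_add f, add_mul, mul_assoc, ← map_mul, ← map_mul, bisect_add,
    bisect_zero_expand, bisect_zero_X_mul_expand, add_zero]

theorem bisect_one_mul_expand (f g : R⟦X⟧) :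
    bisect 1 (f * expand 2 two_ne_zero g) = bisect 1 f * g := by
  conv_lhs => rw [expand_bisect_add f, add_mul, mul_assoc, ← map_mul, ← map_mul, bisect_add,
    bisect_one_expand, bisect_one_X_mul_expand, zero_add]

end Bisect

theorem coeff_pentagonalSeries_zmod_two (n : ℕ) [Decidable (∃ k, pentagonal k = n)] :
    coeff n (pentagonalSeries (ZMod 2)) = if ∃ k, pentagonal k = n then 1 else 0 := by
  split_ifs with h
  · have h1 : coeff n (pentagonalSeries (ZMod 2)) ≠ 0 := by
      rw [Ne, coeff_pentagonalSeries_eq_zero_iff]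
      simpa using h
    revert h1
    generalize coeff n (pentagonalSeries (ZMod 2)) = x
    revert x
    decide
  · exact coeff_pentagonalSeries_eq_zero _ (by simpa using h)

theorem coeff_expand_pentagonalSeries_zmod_two {D : ℕ} (hD : D ≠ 0) (n : ℕ)
    [Decidable (∃ k, D * pentagonal k = n)] :
    coeff n (expand D hD (pentagonalSeries (ZMod 2))) =
      if ∃ k, D * pentagonal k = n then 1 else 0 := by
  classical
  by_cases h : D ∣ n
  · obtain ⟨m, rfl⟩ := h
    rw [coeff_expand_mul, coeff_pentagonalSeries_zmod_two]
    simp [hD]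
  · rw [coeff_expand_of_not_dvd _ _ _ h, if_neg]
    rintro ⟨k, rfl⟩
    exact h (dvd_mul_right _ _)

theorem twentyfour_mul_pentagonal (k : ℤ) :
    24 * (pentagonal k : ℤ) = (6 * k - 1) ^ 2 - 1 := by
  linear_combination 12 * two_mul_natCast_pentagonal k

theorem exists_pentagonal_of_coeff_ne_zero {D n : ℕ} (hD : D ≠ 0)
    (h : coeff n (pentagonalSeries (ZMod 2) * expand D hD (pentagonalSeries (ZMod 2))) ≠ 0) :
    ∃ k m : ℤ, pentagonal k + D * pentagonal m = n := by
  classical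
  rw [coeff_mul] at h
  obtain ⟨⟨i, j⟩, hij, hne⟩ := Finset.exists_ne_zero_of_sum_ne_zero h
  rw [coeff_pentagonalSeries_zmod_two, coeff_expand_pentagonalSeries_zmod_two] at hne
  simp only [ne_eq, mul_eq_zero, not_or, ite_eq_right_iff, one_ne_zero, imp_false, not_not] at hne
  obtain ⟨⟨k, rfl⟩, ⟨m, rfl⟩⟩ := hne
  exact ⟨k, m, Finset.HasAntidiagonal.mem_antidiagonal.mp hij⟩

/-- The coefficient counts `(6k - 1)^2 + D(6m - 1)^2 = 24n + 1 + D`. Putting `6k - 1 = a - Db` and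
`6m - 1 = a + b` turns the left side into `(1 + D)(a^2 + D b^2)`. Here `hmod` recovers `k, m` from
`a, b`, and `hE`, that is `1 + D ∣ 6`, makes `b` integral in the other direction. -/
theorem coeff_pentagonalSeries_mul_expand {D n : ℕ} (hD : D ≠ 0) {M E : ℤ}
    (hE : (1 + D) * E = 6) (hM : (1 + D) * M = 24 * n + 1 + D)
    (hmod : ∀ a b : ℤ, a ^ 2 + D * b ^ 2 = M → (a + b) % 3 = 2 →
      (a - D * b) % 6 = 5 ∧ (a + b) % 6 = 5) :
    coeff n (pentagonalSeries (ZMod 2) * expand D hD (pentagonalSeries (ZMod 2))) =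
      ((formReps D M).card : ZMod 2) := by
  classical
  have hD0 : (0 : ℤ) < D := by positivity
  have hD1 : (1 + D : ℤ) ≠ 0 := by positivity
  rw [coeff_mul]
  simp only [coeff_pentagonalSeries_zmod_two, coeff_expand_pentagonalSeries_zmod_two, ← ite_and,
    mul_ite, mul_one, mul_zero]
  rw [Finset.sum_boole]
  congr 1
  symm
  have key : ∀ p ∈ formReps D M, ∃ k m : ℤ, p.1 - D * p.2 = 6 * k - 1 ∧ p.1 + p.2 = 6 * m - 1 ∧
      (p.1 - D * p.2 + 1) / 6 = k ∧ (p.1 + p.2 + 1) / 6 = m := by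
    intro p hp
    obtain ⟨h1, h2⟩ := (mem_formReps hD0).mp hp
    obtain ⟨h3, h4⟩ := hmod _ _ h1 h2
    refine ⟨(p.1 - D * p.2 + 1) / 6, (p.1 + p.2 + 1) / 6, ?_, ?_, rfl, rfl⟩ <;> omega
  refine Finset.card_bij (fun p _ => (pentagonal ((p.1 - D * p.2 + 1) / 6),
    D * pentagonal ((p.1 + p.2 + 1) / 6))) ?_ ?_ ?_
  · intro p hp
    obtain ⟨k, m, hk, hm, hk', hm'⟩ := key p hp
    obtain ⟨h1, h2⟩ := (mem_formReps hD0).mp hp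
    simp only [Finset.mem_filter, Finset.HasAntidiagonal.mem_antidiagonal, hk', hm']
    refine ⟨?_, ⟨m, rfl⟩, ⟨k, rfl⟩⟩
    have e1 := twentyfour_mul_pentagonal k
    have e2 := twentyfour_mul_pentagonal m
    rw [← hk] at e1
    rw [← hm] at e2
    have : (24 : ℤ) * (pentagonal k + D * pentagonal m) = 24 * n := by
      linear_combination e1 + D * e2 + (1 + D : ℤ) * h1 + hM
    exact_mod_cast mul_left_cancel₀ (by norm_num) this
  · intro p hp q hq h
    obtain ⟨k, m, hk, hm, hk', hm'⟩ := key p hp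
    obtain ⟨k₂, m₂, hk₂, hm₂, hk₂', hm₂'⟩ := key q hq
    simp only [Prod.mk.injEq, hk', hm', hk₂', hm₂', mul_eq_mul_left_iff, hD, or_false,
      pentagonal_inj] at h
    obtain ⟨rfl, rfl⟩ := h
    have h2 : p.2 = q.2 := by
      apply mul_left_cancel₀ hD1
      linear_combination hm - hk - hm₂ + hk₂
    exact Prod.ext (by linear_combination hm - hm₂ - h2) h2
  · rintro ⟨i, j⟩ hij
    simp only [Finset.mem_filter, Finset.HasAntidiagonal.mem_antidiagonal] at hij
    obtain ⟨hn, ⟨m, rfl⟩, ⟨k, rfl⟩⟩ := hij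
    -- Subtracting the two substitutions gives `(1 + D) b = 6(m - k)`, so `b = (m - k) E`.
    have hx : 6 * m - 1 - (m - k) * E - D * ((m - k) * E) = 6 * k - 1 := by
      linear_combination -(m - k) * hE
    refine ⟨(6 * m - 1 - (m - k) * E, (m - k) * E), ?_, ?_⟩
    · rw [mem_formReps hD0]
      refine ⟨?_, by simp only; omega⟩
      apply mul_left_cancel₀ hD1
      have e1 := twentyfour_mul_pentagonal k
      have e2 := twentyfour_mul_pentagonal m
      rw [← hx] at e1
      have hn' : (pentagonal k : ℤ) + D * pentagonal m = n := by exact_mod_cast hn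
      rw [hM]
      simp only
      linear_combination -e1 - D * e2 + 24 * hn'
    · simp only [hx]
      rw [show (6 * k - 1 + 1) / 6 = k by omega,
        show (6 * m - 1 - (m - k) * E + (m - k) * E + 1) / 6 = m by
          rw [sub_add_cancel, sub_add_cancel]; omega]

end PowerSeries

/-! ### The dissection of `f_1 f_5` and its use on the generating function. -/

namespace PowerSeries

open Classical in
/-- The cube of the Euler product is `∑ X ^ (k * (k + 1) / 2)` modulo two. -/
theorem coeff_pentagonalSeries_pow_three (n : ℕ) :
    coeff n (pentagonalSeries (ZMod 2) ^ 3) =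
      if ∃ s : ℤ, 8 * (n : ℤ) + 1 = s ^ 2 then 1 else 0 := by
  rw [pow_succ', ← expand_two_zmod, coeff_pentagonalSeries_mul_expand (M := 8 * n + 1) (E := 2)
    two_ne_zero (by norm_num) (by push_cast; ring)]
  · exact ((natCast_card_formReps_two (8 * n + 1) (8 * n + 1) (by positivity)
      (by push_cast; exact le_rfl)).1 (by omega))
  · intro a b h1 h2
    push_cast at h1 ⊢
    have ha : a ^ 2 % 8 = 1 := odd_sq_emod_eight (by omega)
    have hb : b ^ 2 % 2 = 0 := by omega
    have ha2 : a % 2 = 1 :=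
      Int.odd_iff.mp (Int.odd_pow' two_ne_zero |>.mp (Int.odd_iff.mpr (by omega)))
    have hb2 : b % 2 = 0 := Int.even_iff.mp (Int.even_pow.mp (Int.even_iff.mpr hb)).1
    omega

/-- The coefficient at `n` is odd exactly when `4n + 1` is `s^2` or `5s^2`. The first forces `n =
2m` and the second `n = 10m + 1`, with `8m + 1 = s^2` both times, and these squares are the support
of `f_1^3`. -/
theorem pentagonalSeries_mul_expand_five :
    pentagonalSeries (ZMod 2) * expand 5 (by norm_num) (pentagonalSeries (ZMod 2)) =
      expand 2 two_ne_zero (pentagonalSeries (ZMod 2) ^ 3) +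
        X * expand 2 two_ne_zero (expand 5 (by norm_num) (pentagonalSeries (ZMod 2)) ^ 3) := by
  classical
  have hodd : ∀ {s : ℤ}, s ^ 2 % 2 = 1 → s ^ 2 % 8 = 1 := odd_sq_emod_eight
  ext n
  rw [coeff_pentagonalSeries_mul_expand (M := 4 * n + 1) (E := 1) (by norm_num) (by norm_num)
    (by push_cast; ring)]
  · rw [Nat.cast_ofNat, natCast_card_formReps_five (4 * n + 1) (4 * n + 1) (by positivity)
      (by push_cast; exact le_rfl) (by omega), map_add]
    congr 1
    · by_cases h2 : 2 ∣ n
      · obtain ⟨m, rfl⟩ := h2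
        rw [coeff_expand_mul, coeff_pentagonalSeries_pow_three]
        push_cast
        rw [show (4 : ℤ) * (2 * m) = 8 * m by ring]
      · rw [coeff_expand_of_not_dvd _ _ _ h2, if_neg]
        rintro ⟨s, hs⟩
        have := hodd (s := s) (by omega)
        omega
    · rw [← map_pow, ← expand_mul]
      cases n with
      | zero =>
        rw [coeff_zero_X_mul, if_neg]
        rintro ⟨s, hs⟩
        push_cast at hs
        omega
      | succ n =>
        rw [coeff_succ_X_mul]
        by_cases h10 : 10 ∣ n
        · obtain ⟨m, rfl⟩ := h10
          rw [show 10 * m = 2 * 5 * m by ring, coeff_expand_mul, coeff_pentagonalSeries_pow_three]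
          congr 1
          apply propext
          push_cast
          constructor
          · rintro ⟨s, hs⟩; exact ⟨s, by linarith⟩
          · rintro ⟨s, hs⟩; exact ⟨s, by linarith⟩
        · rw [coeff_expand_of_not_dvd _ _ _ (by omega), if_neg]
          rintro ⟨s, hs⟩
          push_cast at hs
          have := hodd (s := s) (by omega)
          omega
  · intro a b h1 h2
    push_cast at h1 ⊢
    have h : (a + b) % 2 = 1 := by
      rw [← Int.odd_iff]
      have : Odd (a ^ 2 + 5 * b ^ 2) := by rw [h1, Int.odd_iff]; omega
      simpa [Int.odd_add, Int.even_mul, Int.even_pow, Int.odd_pow, show ¬ Even (5 : ℤ) by decide]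
        using this
    omega

/-- A generating function inverse to `f₁ ^ 3 f₅` modulo two has the coefficients of `f₁ f₁₀` in
the residue class `4` modulo `8`. -/
theorem bisect_bisect_bisect_eq {G : (ZMod 2)⟦X⟧}
    (hG : G * (pentagonalSeries (ZMod 2) ^ 3 *
      expand 5 (by norm_num) (pentagonalSeries (ZMod 2))) = 1) :
    bisect 1 (bisect 0 (bisect 0 G)) =
      pentagonalSeries (ZMod 2) * expand 10 (by norm_num) (pentagonalSeries (ZMod 2)) := by
  have hid := pentagonalSeries_mul_expand_five
  have h10 : expand 10 (by norm_num) (pentagonalSeries (ZMod 2)) =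
      expand 5 (by norm_num) (pentagonalSeries (ZMod 2)) ^ 2 := by
    rw [← expand_two_zmod, ← expand_mul]
  rw [h10]
  have hF : pentagonalSeries (ZMod 2) ≠ 0 := by
    rintro h; rw [h] at hG; simp at hG
  have hE : expand 5 (by norm_num) (pentagonalSeries (ZMod 2)) ≠ 0 := by
    rintro h; rw [h] at hG; simp at hG
  generalize expand 5 (by norm_num) (pentagonalSeries (ZMod 2)) = E at *
  generalize pentagonalSeries (ZMod 2) = F at *
  -- Multiplying `G` by the square of `F^2 E` leaves `F E`, whose even part is `F^3`; squares pass
  -- through bisection.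
  have h0 : bisect 0 G * E = F := by
    have h : G * expand 2 two_ne_zero (F ^ 2 * E) =
        expand 2 two_ne_zero (F ^ 3) + X * expand 2 two_ne_zero (E ^ 3) := by
      rw [← hid, expand_two_zmod]
      linear_combination F * E * hG
    have h := congrArg (bisect 0) h
    rw [bisect_zero_mul_expand, bisect_add, bisect_zero_expand, bisect_zero_X_mul_expand] at h
    apply mul_left_cancel₀ (pow_ne_zero 2 hF)
    linear_combination h
  have h00 : bisect 0 (bisect 0 G) * E = F ^ 3 := by
    have h : bisect 0 G * expand 2 two_ne_zero E =
        expand 2 two_ne_zero (F ^ 3) + X * expand 2 two_ne_zero (E ^ 3) := by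
      rw [← hid, expand_two_zmod]
      linear_combination E * h0
    have h := congrArg (bisect 0) h
    rw [bisect_zero_mul_expand, bisect_add, bisect_zero_expand, bisect_zero_X_mul_expand] at h
    linear_combination h
  -- Here `F^3 E = F^2 (F E)`, and the square `F^2` passes through, so the odd part is `E^3 F`.
  have h : bisect 0 (bisect 0 G) * expand 2 two_ne_zero E =
      expand 2 two_ne_zero (F ^ 3 * F) + X * expand 2 two_ne_zero (E ^ 3 * F) := by
    rw [map_mul, map_mul, ← mul_assoc, ← add_mul, ← hid, expand_two_zmod, expand_two_zmod]
    linear_combination E * h00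
  have h := congrArg (bisect 1) h
  rw [bisect_one_mul_expand, bisect_add, bisect_one_expand, bisect_one_X_mul_expand] at h
  apply mul_right_cancel₀ hE
  linear_combination h

/-! ### Reduction of the bracelet generating function modulo 2. -/

open scoped PowerSeries.WithPiTopology in
theorem continuous_map_intCast :
    Continuous (map (Int.castRingHom (ZMod 2))) := by
  rw [continuous_iff_continuousAt]
  intro f
  rw [ContinuousAt, WithPiTopology.tendsto_iff_coeff_tendsto]
  intro d
  simp only [coeff_map]
  exact (continuous_of_discreteTopology.comp (WithPiTopology.continuous_coeff ℤ d)).tendsto f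

open scoped PowerSeries.WithPiTopology in
theorem continuous_expand {p : ℕ} (hp : p ≠ 0) :
    Continuous (expand p hp : (ZMod 2)⟦X⟧ →ₐ[ZMod 2] (ZMod 2)⟦X⟧) := by
  rw [continuous_iff_continuousAt]
  intro f
  rw [ContinuousAt, WithPiTopology.tendsto_iff_coeff_tendsto]
  intro d
  simp only [coeff_expand]
  split_ifs
  · exact (WithPiTopology.continuous_coeff (ZMod 2) _).tendsto f
  · exact tendsto_const_nhds

end PowerSeries

open PowerSeries

-- Only the residue of `a` matters, so `(q; q)_∞`, `(-q; q)_∞` and `(-q^5; q^5)_∞` are all covered.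
open scoped PowerSeries.WithPiTopology in
theorem map_qShiftedFactorial {a : PowerSeries ℤ} {p : ℕ} (hp : p ≠ 0)
    (ha : PowerSeries.constantCoeff a = 0)
    (hap : map (Int.castRingHom (ZMod 2)) a = X ^ p) :
    map (Int.castRingHom (ZMod 2)) (qShiftedFactorial a (X ^ p)) =
      expand p hp (pentagonalSeries (ZMod 2)) := by
  rw [qShiftedFactorial, (qShiftedFactorial_multipliable a (X ^ p) ha (by simp [hp])).map_tprod
    _ continuous_map_intCast, ← WithPiTopology.tprod_one_sub_X_pow,
    (WithPiTopology.multipliable_one_sub_X_pow (ZMod 2)).map_tprod _ (continuous_expand hp)]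
  congr 1
  ext1 j
  simp only [map_sub, map_one, map_mul, map_pow, hap, map_X, expand_X]
  ring

theorem map_mk_bracelet_five_mul :
    map (Int.castRingHom (ZMod 2)) (mk (bracelet 5)) * (pentagonalSeries (ZMod 2) ^ 3 *
      expand 5 (by norm_num) (pentagonalSeries (ZMod 2))) = 1 := by
  have h := congrArg (map (Int.castRingHom (ZMod 2)))
    (braceletGenFun_mul_denominator 5 (by norm_num))
  have hneg : ∀ f : (ZMod 2)⟦X⟧, -f = f := fun f => by
    ext n; simp [ZMod.neg_eq_self_mod_two]
  have h1 : map (Int.castRingHom (ZMod 2)) (qShiftedFactorial X X) = pentagonalSeries (ZMod 2) := by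
    simpa using map_qShiftedFactorial (a := X) (p := 1) one_ne_zero (by simp) (by simp)
  have h2 : map (Int.castRingHom (ZMod 2)) (qShiftedFactorial (-X) X) =
      pentagonalSeries (ZMod 2) := by
    simpa using map_qShiftedFactorial (a := -X) (p := 1) one_ne_zero (by simp) (by simp [hneg])
  have h5 := map_qShiftedFactorial (a := -X ^ 5) (p := 5) (by norm_num) (by simp) (by simp [hneg])
  rw [braceletDenominator, map_mul, map_mul, map_pow, h1, h2, h5] at h
  have hF : pentagonalSeries (ZMod 2) ≠ 0 := by
    rw [← WithPiTopology.tprod_one_sub_X_pow]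
    exact WithPiTopology.tprod_one_sub_X_pow_ne_zero _
  apply mul_left_cancel₀ hF
  linear_combination h

theorem natCast_bracelet_five (N : ℕ) :
    ((bracelet 5 (8 * N + 4) : ℤ) : ZMod 2) =
      coeff N (pentagonalSeries (ZMod 2) *
        expand 10 (by norm_num) (pentagonalSeries (ZMod 2))) := by
  rw [← bisect_bisect_bisect_eq map_mk_bracelet_five_mul]
  simp only [bisect, coeff_mk, coeff_map, eq_intCast]
  congr 2
  ring

/-- The condition on `t` says `i = 8N + 4` and `t = 24N + 11`; completing squares in `N = pentagonal
k + 10 * pentagonal m` gives `t = (6k - 1)^2 + 10(6m - 1)^2`. -/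
theorem bracelet_five_modEq_zero {i t : ℕ} (hi : 3 * i = t + 1) (ht : t % 24 = 11)
    (h : ∀ x y : ℤ, x ^ 2 + 10 * y ^ 2 ≠ t) : bracelet 5 i ≡ 0 [ZMOD 2] := by
  obtain ⟨N, rfl⟩ : ∃ N, i = 8 * N + 4 := ⟨i / 8, by omega⟩
  apply (ZMod.intCast_eq_intCast_iff _ _ 2).mp
  push_cast
  rw [natCast_bracelet_five]
  by_contra hne
  obtain ⟨k, m, hkm⟩ := exists_pentagonal_of_coeff_ne_zero _ hne
  apply h (6 * k - 1) (6 * m - 1)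
  have hkm' : (pentagonal k : ℤ) + 10 * pentagonal m = N := by exact_mod_cast hkm
  have hi' : (3 : ℤ) * (8 * N + 4) = t + 1 := by exact_mod_cast hi
  linear_combination -twentyfour_mul_pentagonal k - 10 * twentyfour_mul_pentagonal m +
    24 * hkm' + hi'

/-! ### Numbers not of the form `x^2 + 10y^2`, and the four progressions. -/

theorem sq_emod_five (x : ℤ) : x ^ 2 % 5 = 0 ∧ x % 5 = 0 ∨ x ^ 2 % 5 = 1 ∨ x ^ 2 % 5 = 4 := by
  rcases (by omega : x % 5 = 0 ∨ x % 5 = 1 ∨ x % 5 = 2 ∨ x % 5 = 3 ∨ x % 5 = 4) with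
    h | h | h | h | h <;> simp [pow_two, Int.mul_emod, h]

theorem sq_add_ten_mul_sq_descent {x y u : ℤ} (h : x ^ 2 + 10 * y ^ 2 = 25 * u) :
    ∃ x' y' : ℤ, x' ^ 2 + 10 * y' ^ 2 = u := by
  have hx := sq_emod_five x
  obtain ⟨x, rfl⟩ : ∃ z, x = 5 * z := ⟨x / 5, by omega⟩
  have h' : 5 * x ^ 2 + 2 * y ^ 2 = 5 * u := by linarith
  have hy := sq_emod_five y
  obtain ⟨y, rfl⟩ : ∃ z, y = 5 * z := ⟨y / 5, by omega⟩
  exact ⟨x, y, by linarith⟩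

theorem sq_add_ten_mul_sq_ne {u : ℤ} (h : ∀ x y : ℤ, x ^ 2 + 10 * y ^ 2 ≠ u) (k : ℕ) :
    ∀ x y : ℤ, x ^ 2 + 10 * y ^ 2 ≠ 25 ^ k * u := by
  induction k with
  | zero => simpa using h
  | succ k ih =>
    intro x y hxy
    obtain ⟨x', y', h'⟩ := sq_add_ten_mul_sq_descent (u := 25 ^ k * u) (by rw [hxy]; ring)
    exact ih x' y' h'

theorem sq_add_ten_mul_sq_ne_of_emod_five {u : ℤ} (hu : u % 5 = 2 ∨ u % 5 = 3) (x y : ℤ) :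
    x ^ 2 + 10 * y ^ 2 ≠ u := by
  have := sq_emod_five x
  omega

/-- After `5 ∣ x` is cancelled, `u ≡ 2y^2` modulo 5, which is 0 or `±2`. -/
theorem sq_add_ten_mul_sq_ne_five_mul {u : ℤ} (hu : u % 5 = 1 ∨ u % 5 = 4) (x y : ℤ) :
    x ^ 2 + 10 * y ^ 2 ≠ 5 * u := by
  intro h
  have hx := sq_emod_five x
  obtain ⟨x, rfl⟩ : ∃ z, x = 5 * z := ⟨x / 5, by omega⟩
  have h' : 5 * x ^ 2 + 2 * y ^ 2 = u := by linarith
  have hy := sq_emod_five y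
  omega

theorem twentyfive_pow_emod (k : ℕ) : 25 ^ k % 24 = 1 := by
  rw [Nat.pow_mod]; simp

theorem bracelet_five_odd_power {c : ℕ} (hc : c % 24 = 7) (hc5 : c % 5 = 1 ∨ c % 5 = 4)
    (β n : ℕ) :
    bracelet 5 (8 * 5 ^ (2 * (β + 1)) * n + (c * 5 ^ (2 * (β + 1) - 1) + 1) / 3) ≡ 0 [ZMOD 2] := by
  have e1 : 5 ^ (2 * (β + 1)) = 25 * 25 ^ β := by rw [pow_mul]; ring
  have e2 : 5 ^ (2 * (β + 1) - 1) = 5 * 25 ^ β := by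
    rw [show 2 * (β + 1) - 1 = 2 * β + 1 by omega, pow_succ, pow_mul]; ring
  have hp := twentyfive_pow_emod β
  rw [e1, e2]
  -- `7 * 5 = 35 ≡ 11` and `25 ≡ 1` modulo 24; in particular the division by 3 is exact.
  have hmod : (c * (5 * 25 ^ β)) % 24 = 11 := by
    simp [Nat.mul_mod, hc, hp]
  refine bracelet_five_modEq_zero (t := 25 ^ β * (5 * (120 * n + c))) ?_ ?_ ?_
  · have : 25 ^ β * (5 * (120 * n + c)) = 3 * (8 * (25 * 25 ^ β) * n) + c * (5 * 25 ^ β) := by ring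
    omega
  · have : 25 ^ β * (5 * (120 * n + c)) = 24 * (25 * 25 ^ β * n) + c * (5 * 25 ^ β) := by ring
    omega
  · push_cast
    exact sq_add_ten_mul_sq_ne (sq_add_ten_mul_sq_ne_five_mul (by omega)) β

theorem bracelet_five_even_power {c : ℕ} (hc : c % 24 = 11) (hc5 : c % 5 = 2 ∨ c % 5 = 3)
    (α n : ℕ) :
    bracelet 5 (8 * 5 ^ (2 * α + 1) * n + (c * 5 ^ (2 * α) + 1) / 3) ≡ 0 [ZMOD 2] := by
  have e1 : 5 ^ (2 * α + 1) = 5 * 25 ^ α := by rw [pow_succ, pow_mul]; ring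
  have e2 : 5 ^ (2 * α) = 25 ^ α := by rw [pow_mul]; norm_num
  have hp := twentyfive_pow_emod α
  rw [e1, e2]
  have hmod : (c * 25 ^ α) % 24 = 11 := by
    simp [Nat.mul_mod, hc, hp]
  refine bracelet_five_modEq_zero (t := 25 ^ α * (120 * n + c)) ?_ ?_ ?_
  · have : 25 ^ α * (120 * n + c) = 3 * (8 * (5 * 25 ^ α) * n) + c * 25 ^ α := by ring
    omega
  · have : 25 ^ α * (120 * n + c) = 24 * (5 * 25 ^ α * n) + c * 25 ^ α := by ring
    omega
  · push_cast
    exact sq_add_ten_mul_sq_ne (sq_add_ten_mul_sq_ne_of_emod_five (by omega)) α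

theorem mainTheorem2 (α n : ℕ) (hα : 1 ≤ α) :
    bracelet 5 (8 * 5 ^ (2 * α) * n + (31 * 5 ^ (2 * α - 1) + 1) / 3) ≡ 0 [ZMOD 2] ∧
    bracelet 5 (8 * 5 ^ (2 * α) * n + (79 * 5 ^ (2 * α - 1) + 1) / 3) ≡ 0 [ZMOD 2] ∧
    bracelet 5 (8 * 5 ^ (2 * α + 1) * n + (83 * 5 ^ (2 * α) + 1) / 3) ≡ 0 [ZMOD 2] ∧
    bracelet 5 (8 * 5 ^ (2 * α + 1) * n + (107 * 5 ^ (2 * α) + 1) / 3) ≡ 0 [ZMOD 2] := by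
  obtain ⟨β, rfl⟩ : ∃ β, α = β + 1 := ⟨α - 1, by omega⟩
  exact ⟨bracelet_five_odd_power (by norm_num) (by norm_num) β n,
    bracelet_five_odd_power (by norm_num) (by norm_num) β n,
    bracelet_five_even_power (by norm_num) (by norm_num) (β + 1) n,
    bracelet_five_even_power (by norm_num) (by norm_num) (β + 1) n⟩
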